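/- Let $L_n$ denote the Lucas numbers, defined by $L_0=2$, $L_1=1$ and $L_n=L_{n-1}+L_{n-2}$ for $n>1$, and let $H_{n}(1)=\sum_{k=1}^{n}\frac1k$ denote the $n$th harmonic number. For rational numbers $a,b$, a prime $p$ and $m\ge 0$, write $a\equiv b\pmod{p^m}$ if $a-b=p^m r$ for some rational number $r$ whose denominator in lowest terms is not divisible by $p$. Let $p$ be an odd prime. Then $L_p\equiv 1\pmod p$, and $$ \sum_{k=1}^{p-1}\frac{L_{2k}}{k}\equiv \frac{1-L_p^2}{2p}+\frac{12}{5}\,H_{p-1}(1)\pmod{p^3}. $$ -/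

import Mathlib

/-- The Lucas numbers: `L 0 = 2`, `L 1 = 1`, `L (n + 2) = L (n + 1) + L n`. -/
def lucasNumber : ℕ → ℕ
  | 0 => 2
  | 1 => 1
  | n + 2 => lucasNumber (n + 1) + lucasNumber n

/-- The congruence `a ≡ b (mod p ^ m)` of rational numbers, for a prime `p`: the difference is
`p ^ m` times a rational number whose denominator in lowest terms is prime to `p`. -/
def RatModEqPrimePow (p m : ℕ) (a b : ℚ) : Prop :=
  ∃ r : ℚ, ¬ p ∣ r.den ∧ a - b = (p : ℚ) ^ m * r

open Finset

/-! With `n + 1 = p`, expanding `L_{2k}` in binomials and summing over `k`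
(`sum_lucasNumber_two_mul_div`) leaves, beyond `(1 - L_p²)/(2p) + 2H_{p-1}`, a sum of `p/(2(j+1)²) ·
C(p+j, 2j+1)`. Writing the binomials as ratios of sine products (`choose_eq_sineProd`), with
`sineProd p j ≡ 1` mod `p²`, turns it mod `p³` into `p²/2 · A`, where `A` is a partial sum of
Apéry's series for `ζ(3)`. By `sum_inv_cube_eq`, `∑ 1/k³ = 5/4 · A + R`. The left side is divisible
by `p`, and `R` is `-H_{p-1}/p²` up to a multiple of `p`, so `p²/2 · A ≡ 2/5 · H_{p-1}`; with
`2H_{p-1}` this makes `12/5`. The argument inverts 2 and 5, so `p = 5` is separate. -/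

/-! ### Finite sine products and Apéry's identity -/

/-- The finite product `∏ (1 - x² / i²)` over `1 ≤ i ≤ m`. -/
def sineProd (x : ℚ) (m : ℕ) : ℚ := ∏ i ∈ range m, (1 - x ^ 2 / ((i : ℚ) + 1) ^ 2)

theorem sineProd_zero (x : ℚ) : sineProd x 0 = 1 := by simp [sineProd]

theorem sineProd_succ (x : ℚ) (m : ℕ) :
    sineProd x (m + 1) = sineProd x m * (1 - x ^ 2 / ((m : ℚ) + 1) ^ 2) :=
  prod_range_succ _ _

theorem sineProd_ne_zero {n m : ℕ} (h : m < n) : sineProd n m ≠ 0 := by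
  refine prod_ne_zero_iff.2 fun i hi h0 => ?_
  rw [mem_range] at hi
  have h1 : ((i : ℚ) + 1) ≠ 0 := by positivity
  have h2 : ((i : ℚ) + 1) < n := by exact_mod_cast (by omega : i + 1 < n)
  have h3 : (0 : ℚ) ≤ i := by positivity
  field_simp at h0
  nlinarith

theorem sineProd_add_one (x : ℚ) (m : ℕ) :
    sineProd (x + 1) m * ((m - x) * (x + 1)) = -x * (x + m + 1) * sineProd x m := by
  induction m with
  | zero => simp [sineProd_zero]
  | succ m ih =>
    have h1 : ((m : ℚ) + 1) ≠ 0 := by positivity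
    rw [sineProd_succ, sineProd_succ]
    push_cast
    field_simp
    linear_combination ((m + 1 - x) * (m + 2 + x)) * ih

/-- The diagonal values are `(-1)^m C(2m+2, m+1) / 2`; this is their recurrence. -/
theorem sineProd_diag_succ (m : ℕ) :
    sineProd ((m : ℚ) + 2) (m + 1) * (m + 2) =
      -2 * (2 * m + 3) * sineProd ((m : ℚ) + 1) m := by
  have h := sineProd_add_one ((m : ℚ) + 1) m
  have h1 : ((m : ℚ) + 1) ≠ 0 := by positivity
  rw [sineProd_succ]
  rw [show (m : ℚ) + 1 + 1 = m + 2 by ring] at h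
  field_simp
  linear_combination (2 * m + 3) * h

theorem choose_succ_succ_mul (n m : ℕ) :
    ((n + m + 1).choose (2 * m + 3) : ℚ) * ((2 * m + 2) * (2 * m + 3)) =
      (n + m).choose (2 * m + 1) * ((n + m + 1) * (n - m - 1)) := by
  have h1 := Nat.add_one_mul_choose_eq (n + m) (2 * m + 2)
  have h2 := Nat.choose_succ_right_eq (n + m) (2 * m + 1)
  have h3 : ((n + m).choose (2 * m + 2) : ℚ) * (2 * m + 2) =
      (n + m).choose (2 * m + 1) * (n - m - 1) := by
    rcases Nat.lt_or_ge m n with h | h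
    · obtain ⟨d, rfl⟩ := Nat.exists_eq_add_of_lt h
      rw [show m + d + 1 + m - (2 * m + 1) = d by omega] at h2
      have h2 : ((m + d + 1 + m).choose (2 * m + 2) : ℚ) * ((2 * m + 1 : ℕ) + 1) =
        (m + d + 1 + m).choose (2 * m + 1) * d := by exact_mod_cast h2
      push_cast at h2 ⊢
      linear_combination h2
    · rw [Nat.choose_eq_zero_of_lt (by omega), Nat.choose_eq_zero_of_lt (by omega)]
      simp
  have h1 : ((n : ℚ) + m + 1) * (n + m).choose (2 * m + 2) =
      (n + m + 1).choose (2 * m + 3) * (2 * m + 3) := by exact_mod_cast h1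
  linear_combination (-(2 * m + 2 : ℚ)) * h1 + ((n : ℚ) + m + 1) * h3

theorem choose_eq_sineProd (n m : ℕ) :
    ((n + m).choose (2 * m + 1) : ℚ) =
      n / (m + 1) * (sineProd n m / sineProd ((m : ℚ) + 1) m) := by
  induction m with
  | zero => simp [sineProd_zero]
  | succ m ih =>
    have h := choose_succ_succ_mul n m
    have hd := sineProd_diag_succ m
    have h0 := sineProd_ne_zero (show m < m + 1 by omega)
    have h1 := sineProd_ne_zero (show m + 1 < m + 2 by omega)
    have h2 : ((m : ℚ) + 1) ≠ 0 := by positivity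
    have h3 : ((m : ℚ) + 2) ≠ 0 := by positivity
    have h4 : (2 * (m : ℚ) + 3) ≠ 0 := by positivity
    have h5 : (2 * (m : ℚ) + 2) ≠ 0 := by positivity
    rw [ih] at h
    push_cast at h0 h1 ⊢
    rw [show n + (m + 1) = n + m + 1 by ring, show 2 * (m + 1) + 1 = 2 * m + 3 by ring,
      show (m : ℚ) + 1 + 1 = m + 2 by ring, sineProd_succ n,
      eq_div_of_mul_eq h3 hd,
      eq_div_of_mul_eq (mul_ne_zero h5 h4) h]
    field_simp
    ring

/-- Telescopes: each term is `1/n²` times `1 / sineProd n k - 1 / sineProd n (k + 1)`. -/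
theorem sum_inv_sineProd (n m : ℕ) (h : m < n) :
    ∑ k ∈ range m, 1 / (((n : ℚ) ^ 2 - (k + 1) ^ 2) * sineProd n k) =
      1 / (n : ℚ) ^ 2 * (1 - 1 / sineProd n m) := by
  induction m with
  | zero => simp [sineProd_zero]
  | succ m ih =>
    rw [sum_range_succ, ih (by omega)]
    have h0 := sineProd_ne_zero (show m < n by omega)
    have h1 := sineProd_ne_zero h
    rw [sineProd_succ] at h1 ⊢
    have h2 : ((m : ℚ) + 1) ≠ 0 := by positivity
    have h3 : ((m : ℚ) + 1) < n := by exact_mod_cast (by omega : m + 1 < n)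
    have h5 : (0 : ℚ) ≤ m := by positivity
    have h4 : (n : ℚ) ^ 2 - (m + 1) ^ 2 ≠ 0 := by nlinarith
    have h6 : (n : ℚ) ≠ 0 := by linarith
    have h7 : 1 - (n : ℚ) ^ 2 / (m + 1) ^ 2 = - ((n : ℚ) ^ 2 - (m + 1) ^ 2) / (m + 1) ^ 2 := by
      field_simp
      ring
    rw [h7]
    field_simp
    ring

/-- The finite form of Apéry's series acceleration for `∑ 1 / k ^ 3`. -/
theorem sum_inv_cube_eq (n : ℕ) :
    ∑ k ∈ range n, 1 / ((k : ℚ) + 1) ^ 3 =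
      5 / 4 * ∑ k ∈ range n, 1 / (((k : ℚ) + 1) ^ 3 * sineProd ((k : ℚ) + 1) k) +
      ∑ k ∈ range n, 1 / (2 * ((n : ℚ) + 1) * (k + 1) * (k - n) * sineProd ((n : ℚ) + 1) k) := by
  induction n with
  | zero => simp
  | succ n ih =>
    -- The increment of the remainder: a telescoping sum plus the new term `k = n`. The `1/4` from
    -- that term and the `1` from telescoping make `5/4`.
    have key : ∑ k ∈ range (n + 1), 1 / (2 * (((n + 1 : ℕ) : ℚ) + 1) * (k + 1) * (k - (n + 1 : ℕ)) *
          sineProd (((n + 1 : ℕ) : ℚ) + 1) k) -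
        ∑ k ∈ range n, 1 / (2 * ((n : ℚ) + 1) * (k + 1) * (k - n) * sineProd ((n : ℚ) + 1) k) =
        1 / ((n : ℚ) + 1) * ∑ k ∈ range n,
          1 / ((((n + 1 : ℕ) : ℚ) ^ 2 - (k + 1) ^ 2) * sineProd (n + 1 : ℕ) k) -
        1 / (4 * ((n : ℚ) + 1) ^ 3 * sineProd ((n : ℚ) + 1) n) := by
      have hterm : ∀ k ∈ range (n + 1), 1 / (2 * (((n + 1 : ℕ) : ℚ) + 1) * (k + 1) *
          (k - (n + 1 : ℕ)) * sineProd (((n + 1 : ℕ) : ℚ) + 1) k) =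
          -1 / (2 * (k + 1) * ((n : ℚ) + 1) * (n + k + 2) * sineProd ((n : ℚ) + 1) k) := by
        intro k _
        have h := sineProd_add_one ((n + 1 : ℕ) : ℚ) k
        rw [show 2 * (((n + 1 : ℕ) : ℚ) + 1) * (k + 1) *
          (k - (n + 1 : ℕ)) * sineProd (((n + 1 : ℕ) : ℚ) + 1) k = 2 * (k + 1) *
            (sineProd (((n + 1 : ℕ) : ℚ) + 1) k * ((k - (n + 1 : ℕ)) * (((n + 1 : ℕ) : ℚ) + 1)))
            by ring, h, neg_div, ← div_neg]
        congr 1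
        push_cast
        ring
      rw [sum_congr rfl hterm, sum_range_succ, add_sub_right_comm, ← sum_sub_distrib, mul_sum,
        sub_eq_add_neg]
      congr 1
      · refine sum_congr rfl fun k hk => ?_
        rw [mem_range] at hk
        have h0 := sineProd_ne_zero (show k < n + 1 by omega)
        push_cast at h0 ⊢
        have h3 : (k : ℚ) < n := by exact_mod_cast hk
        have h5 : (0 : ℚ) ≤ k := by positivity
        have h1 : ((k : ℚ) + 1) ≠ 0 := by positivity
        have h2 : ((n : ℚ) + 1) ≠ 0 := by positivity
        have h4 : (k : ℚ) - n ≠ 0 := by linarith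
        have h6 : (n : ℚ) + k + 2 ≠ 0 := by positivity
        rw [show ((n : ℚ) + 1) ^ 2 - (k + 1) ^ 2 = - ((k - n) * (n + k + 2)) by ring]
        field_simp
        ring
      · have h0 := sineProd_ne_zero (show n < n + 1 by omega)
        push_cast at h0 ⊢
        have h2 : ((n : ℚ) + 1) ≠ 0 := by positivity
        rw [show (n : ℚ) + n + 2 = 2 * (n + 1) by ring]
        field_simp
        ring
    rw [sum_inv_sineProd (n + 1) n (by omega)] at key
    rw [sum_range_succ, ih, sum_range_succ _ n, eq_add_of_sub_eq key]
    have h0 := sineProd_ne_zero (show n < n + 1 by omega)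
    push_cast at h0 ⊢
    have h2 : ((n : ℚ) + 1) ≠ 0 := by positivity
    field_simp
    ring

/-! ### Binomial expansion of the Lucas sum -/

/-- The range is padded with vanishing binomials to a bound independent of `k`, so that sums over
`k` and `j` can later be exchanged. -/
theorem fib_eq_sum_choose (k N : ℕ) (h : k ≤ N) :
    Nat.fib (2 * k) = ∑ j ∈ range N, (k + j).choose (2 * j + 1) ∧
    Nat.fib (2 * k + 1) = ∑ j ∈ range (N + 1), (k + j).choose (2 * j) := by
  induction k with
  | zero =>
    refine ⟨(sum_eq_zero fun j _ => Nat.choose_eq_zero_of_lt (by omega)).symm, ?_⟩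
    rw [sum_range_succ', sum_eq_zero fun j _ => Nat.choose_eq_zero_of_lt (by omega)]
    simp
  | succ k ih =>
    obtain ⟨h1, h2⟩ := ih (by omega)
    have h3 : Nat.fib (2 * (k + 1)) = ∑ j ∈ range N, (k + 1 + j).choose (2 * j + 1) := by
      rw [show 2 * (k + 1) = 2 * k + 2 by ring, Nat.fib_add_two, h1, h2, sum_range_succ,
        Nat.choose_eq_zero_of_lt (show k + N < 2 * N by omega), add_zero, ← sum_add_distrib]
      refine sum_congr rfl fun j _ => ?_
      rw [show k + 1 + j = k + j + 1 by ring, Nat.choose_succ_succ']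
      ring
    refine ⟨h3, ?_⟩
    rw [show 2 * (k + 1) + 1 = 2 * k + 1 + 2 by ring, Nat.fib_add_two,
      show 2 * k + 1 + 1 = 2 * (k + 1) by ring, h3, h2, sum_range_succ', sum_range_succ',
      add_right_comm, ← sum_add_distrib]
    simp only [mul_zero, Nat.choose_zero_right]
    congr 1
    refine sum_congr rfl fun j _ => ?_
    rw [show k + 1 + (j + 1) = k + (j + 1) + 1 by ring, show 2 * (j + 1) = 2 * j + 1 + 1 by ring,
      Nat.choose_succ_succ', show k + (j + 1) = k + 1 + j by ring]
    ring

theorem lucasNumber_succ (n : ℕ) : lucasNumber (n + 1) = Nat.fib (n + 2) + Nat.fib n := by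
  induction n using Nat.twoStepInduction with
  | zero => rfl
  | one => rfl
  | more n h1 h2 =>
    rw [lucasNumber, h1, h2, Nat.fib_add_two (n := n + 2), Nat.fib_add_two (n := n)]
    ring

theorem lucasNumber_two_mul (k N : ℕ) (h : k < N) :
    (lucasNumber (2 * (k + 1)) : ℚ) =
      2 + ∑ j ∈ range N, ((k : ℚ) + 1) / (j + 1) * (k + 1 + j).choose (2 * j + 1) := by
  rw [show 2 * (k + 1) = 2 * k + 1 + 1 by ring, lucasNumber_succ, (fib_eq_sum_choose k N h.le).2,
    show 2 * k + 1 + 2 = 2 * (k + 1) + 1 by ring, (fib_eq_sum_choose (k + 1) N h).2,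
    sum_range_succ', sum_range_succ', add_add_add_comm, ← sum_add_distrib]
  simp only [mul_zero, Nat.choose_zero_right]
  push_cast
  rw [add_comm]
  congr 1
  refine sum_congr rfl fun j _ => ?_
  have h1 : ((j : ℚ) + 1) ≠ 0 := by positivity
  have e1 := Nat.choose_succ_succ' (k + 1 + j) (2 * j + 1)
  have e2 : ((k + 1 + j).choose (2 * j + 2) : ℚ) * (2 * j + 2) =
      (k + 1 + j).choose (2 * j + 1) * (k - j) := by
    have := Nat.choose_succ_right_eq (k + 1 + j) (2 * j + 1)
    rcases Nat.lt_or_ge k j with hj | hj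
    · rw [Nat.choose_eq_zero_of_lt (by omega), Nat.choose_eq_zero_of_lt (by omega)]
      simp
    · obtain ⟨d, rfl⟩ := Nat.exists_eq_add_of_le hj
      rw [show j + d + 1 + j - (2 * j + 1) = d by omega] at this
      have h2 : ((j + d + 1 + j).choose (2 * j + 2) : ℚ) * ((2 * j + 1 : ℕ) + 1) =
        (j + d + 1 + j).choose (2 * j + 1) * d := by exact_mod_cast this
      push_cast at h2 ⊢
      linear_combination h2
  rw [show k + 1 + (j + 1) = k + 1 + j + 1 by ring, show k + (j + 1) = k + 1 + j by ring,
    show 2 * (j + 1) = 2 * j + 1 + 1 by ring, e1]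
  push_cast
  field_simp
  linear_combination e2

theorem lucasNumber_sq (m : ℕ) :
    (lucasNumber m : ℤ) ^ 2 = lucasNumber (2 * m) + 2 * (-1) ^ m := by
  -- The induction closes only with the next square and the mixed product included.
  suffices h : (lucasNumber m : ℤ) ^ 2 = lucasNumber (2 * m) + 2 * (-1) ^ m ∧
      (lucasNumber (m + 1) : ℤ) ^ 2 = lucasNumber (2 * m + 2) + 2 * (-1) ^ (m + 1) ∧
      (lucasNumber (m + 1) : ℤ) * lucasNumber m = lucasNumber (2 * m + 1) + (-1) ^ m from h.1
  induction m with
  | zero => simp [lucasNumber]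
  | succ m ih =>
    obtain ⟨h1, h2, h3⟩ := ih
    have r (n : ℕ) : (lucasNumber (n + 2) : ℤ) = lucasNumber (n + 1) + lucasNumber n := by
      rw [lucasNumber]; push_cast; rfl
    have r0 := r m
    have r1 := r (2 * m)
    have r2 := r (2 * m + 1)
    have r3 := r (2 * m + 2)
    simp only [show 2 * (m + 1) = 2 * m + 2 by ring, add_assoc, Nat.reduceAdd] at *
    refine ⟨h2, ?_, ?_⟩
    · rw [r0, r3, r2]
      linear_combination h1 + h2 + 2 * h3 - r1
    · rw [r0, r2]
      linear_combination h2 + h3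

theorem sum_choose_hockey (n j : ℕ) :
    ∑ k ∈ range n, (k + 1 + j).choose (2 * j + 1) = (n + 1 + j).choose (2 * j + 2) := by
  induction n with
  | zero => simp [Nat.choose_eq_zero_of_lt (show 1 + j < 2 * j + 2 by omega)]
  | succ n ih =>
    rw [sum_range_succ, ih, show n + 1 + 1 + j = n + 1 + j + 1 by ring,
      Nat.choose_succ_succ' _ (2 * j + 1)]
    ring

theorem sum_lucasNumber_two_mul_div (n : ℕ) (hn : Odd (n + 1)) :
    ∑ k ∈ range n, (lucasNumber (2 * (k + 1)) : ℚ) / (k + 1) =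
      (1 - (lucasNumber (n + 1) : ℚ) ^ 2) / (2 * (n + 1)) + 2 * harmonic n +
      ∑ j ∈ range n, ((n : ℚ) + 1) / (2 * (j + 1) ^ 2) * (n + 1 + j).choose (2 * j + 1) := by
  have hsq : (lucasNumber (n + 1) : ℚ) ^ 2 = lucasNumber (2 * (n + 1)) - 2 := by
    have h := lucasNumber_sq (n + 1)
    rw [hn.neg_one_pow] at h
    have h : (lucasNumber (n + 1) : ℚ) ^ 2 = lucasNumber (2 * (n + 1)) + 2 * (-1) := by
      exact_mod_cast h
    linear_combination h
  have h1 : ((n : ℚ) + 1) ≠ 0 := by positivity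
  -- The top term `j = n` equals 1 and cancels the 1 in `1 - L_p²`.
  rw [lucasNumber_two_mul n (n + 1) (by omega), sum_range_succ, div_self h1,
    show n + 1 + n = 2 * n + 1 by ring, Nat.choose_self] at hsq
  have hS : ∑ k ∈ range n, (lucasNumber (2 * (k + 1)) : ℚ) / (k + 1) =
      2 * harmonic n + ∑ j ∈ range n, 1 / ((j : ℚ) + 1) * (n + 1 + j).choose (2 * j + 2) := by
    have : ∀ k ∈ range n, (lucasNumber (2 * (k + 1)) : ℚ) / (k + 1) =
        2 * ((k + 1 : ℕ) : ℚ)⁻¹ +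
          ∑ j ∈ range n, 1 / ((j : ℚ) + 1) * (k + 1 + j).choose (2 * j + 1) := by
      intro k hk
      have h2 : ((k : ℚ) + 1) ≠ 0 := by positivity
      rw [lucasNumber_two_mul k n (mem_range.1 hk), add_div, sum_div]
      push_cast
      congr 1
      refine sum_congr rfl fun j _ => ?_
      field_simp
    rw [sum_congr rfl this, sum_add_distrib, ← mul_sum, sum_comm, harmonic]
    congr 1
    refine sum_congr rfl fun j _ => ?_
    rw [← mul_sum, ← Nat.cast_sum, sum_choose_hockey]
  rw [hS, hsq, show ∀ x : ℚ, 1 - (2 + (x + 1 * (1 : ℕ)) - 2) = -x by intro x; push_cast; ring,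
    neg_div, sum_div, add_right_comm, add_comm, ← sum_neg_distrib, ← sum_add_distrib]
  congr 1
  refine sum_congr rfl fun j hj => ?_
  have h2 : ((j : ℚ) + 1) ≠ 0 := by positivity
  have e := Nat.choose_succ_right_eq (n + 1 + j) (2 * j + 1)
  obtain ⟨d, rfl⟩ := Nat.exists_eq_add_of_lt (mem_range.1 hj)
  rw [show j + d + 1 + 1 + j - (2 * j + 1) = d + 1 by omega] at e
  have e' : ((j + d + 1 + 1 + j).choose (2 * j + 2) : ℚ) * ((2 * j + 1 : ℕ) + 1) =
        (j + d + 1 + 1 + j).choose (2 * j + 1) * (d + 1) := by exact_mod_cast e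
  push_cast at e' h1 ⊢
  field_simp
  linear_combination e'

/-- `L_n` is the trace of the `n`th power of the Fibonacci matrix, and over `ZMod p` the trace of a
`p`th power is the `p`th power of the trace. -/
theorem lucasNumber_prime_modEq (p : ℕ) (hp : p.Prime) :
    (lucasNumber p : ℤ) ≡ 1 [ZMOD (p : ℤ)] := by
  have := Fact.mk hp
  rw [← ZMod.intCast_eq_intCast_iff]
  let M : Matrix (Fin 2) (Fin 2) (ZMod p) := !![1, 1; 1, 0]
  have hM : M ^ 2 = M + 1 := by
    ext i j
    fin_cases i <;> fin_cases j <;> simp [M, sq, Matrix.mul_apply, Fin.sum_univ_two]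
  have htr : ∀ n, (M ^ n).trace = (lucasNumber n : ZMod p) := by
    intro n
    induction n using Nat.twoStepInduction with
    | zero => simp [lucasNumber]
    | one => simp [lucasNumber, M, Matrix.trace_fin_two]
    | more n h1 h2 =>
      rw [pow_add, hM, mul_add, mul_one, ← pow_succ, Matrix.trace_add, h1, h2, lucasNumber]
      push_cast
      rfl
  have h := ZMod.trace_pow_card M
  rw [htr] at h
  simpa [M, Matrix.trace_fin_two] using h

/-! ### `p`-integrality and congruences -/

/-- The localization of `ℤ` at a prime `p`, as a subring of `ℚ`. -/
def primeLocalSubring (p : ℕ) (hp : p.Prime) : Subring ℚ where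
  carrier := {r | ¬ p ∣ r.den}
  mul_mem' {a b} ha hb h :=
    ((hp.dvd_mul).1 (h.trans (Rat.mul_den_dvd a b))).elim ha hb
  one_mem' := by simpa using hp.one_lt.ne'
  add_mem' {a b} ha hb h :=
    ((hp.dvd_mul).1 (h.trans (Rat.add_den_dvd a b))).elim ha hb
  zero_mem' := by simpa using hp.one_lt.ne'
  neg_mem' {a} ha := by simpa using ha

theorem inv_intCast_mem_primeLocalSubring {p : ℕ} (hp : p.Prime) {z : ℤ} (hz : ¬ (p : ℤ) ∣ z) :
    (z : ℚ)⁻¹ ∈ primeLocalSubring p hp := by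
  intro h
  apply hz
  have h0 : z ≠ 0 := by rintro rfl; simp at hz
  rw [Rat.inv_intCast_den, if_neg h0] at h
  exact Int.natCast_dvd.2 h

theorem inv_add_one_mem {p : ℕ} (hp : p.Prime) {k : ℕ} (hk : k + 1 < p) :
    ((k : ℚ) + 1)⁻¹ ∈ primeLocalSubring p hp := by
  have h := inv_intCast_mem_primeLocalSubring hp (z := k + 1) fun h => by
    have := Int.le_of_dvd (by positivity) h
    omega
  exact_mod_cast h

theorem inv_sub_mem {p : ℕ} (hp : p.Prime) {k : ℕ} (hk : k + 1 < p) :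
    ((k : ℚ) + 1 - p)⁻¹ ∈ primeLocalSubring p hp := by
  have h := inv_intCast_mem_primeLocalSubring hp (z := k + 1 - p) fun h => by
    have := Int.le_of_dvd (by positivity) ((dvd_sub_self_right).1 h)
    omega
  exact_mod_cast h

theorem inv_add_mem {p : ℕ} (hp : p.Prime) {k : ℕ} (hk : k + 1 < p) :
    ((k : ℚ) + 1 + p)⁻¹ ∈ primeLocalSubring p hp := by
  have h := inv_intCast_mem_primeLocalSubring hp (z := k + 1 + p) fun h => by
    have := Int.le_of_dvd (by positivity) ((dvd_add_self_right).1 h)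
    omega
  exact_mod_cast h

theorem exists_sineProd_eq {p : ℕ} (hp : p.Prime) {m : ℕ} (hm : m < p) :
    ∃ e ∈ primeLocalSubring p hp, sineProd p m = 1 + (p : ℚ) ^ 2 * e := by
  induction m with
  | zero => exact ⟨0, zero_mem _, by simp [sineProd_zero]⟩
  | succ m ih =>
    obtain ⟨e, he, h⟩ := ih (by omega)
    have hi := pow_mem (inv_add_one_mem hp hm) 2
    have hp' := natCast_mem (primeLocalSubring p hp) p
    refine ⟨e - ((m : ℚ) + 1)⁻¹ ^ 2 * (1 + p ^ 2 * e),
      sub_mem he (mul_mem hi (add_mem (one_mem _) (mul_mem (pow_mem hp' 2) he))), ?_⟩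
    rw [sineProd_succ, h, div_eq_mul_inv, inv_pow]
    ring

theorem exists_inv_sineProd_eq {p : ℕ} (hp : p.Prime) {m : ℕ} (hm : m < p) :
    ∃ e ∈ primeLocalSubring p hp, (sineProd p m)⁻¹ = 1 + (p : ℚ) ^ 2 * e := by
  induction m with
  | zero => exact ⟨0, zero_mem _, by simp [sineProd_zero]⟩
  | succ m ih =>
    obtain ⟨e, he, h⟩ := ih (by omega)
    have h1 := inv_sub_mem hp hm
    have h2 := inv_add_mem hp hm
    have hp' := natCast_mem (primeLocalSubring p hp) p
    have h3 : (1 - (p : ℚ) ^ 2 / ((m : ℚ) + 1) ^ 2)⁻¹ =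
        1 + p ^ 2 * (((m : ℚ) + 1 - p)⁻¹ * ((m : ℚ) + 1 + p)⁻¹) := by
      have a1 : ((m : ℚ) + 1) ≠ 0 := by positivity
      have a2 : ((m : ℚ) + 1 + p) ≠ 0 := by positivity
      have a3 : ((m : ℚ) + 1 - p) ≠ 0 := by
        have : (m : ℚ) + 1 < p := by exact_mod_cast hm
        linarith
      rw [show 1 - (p : ℚ) ^ 2 / ((m : ℚ) + 1) ^ 2 =
        (m + 1 - p) * (m + 1 + p) / (m + 1) ^ 2 by field_simp; ring]
      field_simp
      ring
    refine ⟨e + ((m : ℚ) + 1 - p)⁻¹ * ((m : ℚ) + 1 + p)⁻¹ * (1 + p ^ 2 * e),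
      add_mem he (mul_mem (mul_mem h1 h2) (add_mem (one_mem _) (mul_mem (pow_mem hp' 2) he))), ?_⟩
    rw [sineProd_succ, mul_inv, h, h3]
    ring

theorem sum_inv_sub_eq_neg_harmonic (n : ℕ) :
    ∑ k ∈ range n, ((k : ℚ) - n)⁻¹ = - harmonic n := by
  rw [harmonic, ← sum_range_reflect, ← sum_neg_distrib]
  refine sum_congr rfl fun k hk => ?_
  obtain ⟨d, rfl⟩ := Nat.exists_eq_add_of_lt (mem_range.1 hk)
  rw [show k + d + 1 - 1 - k = d by omega, ← inv_neg]
  push_cast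
  congr 1
  ring

/-- Pair `i` with `p - i`: `1/i + 1/(p-i)` is divisible by `p` and divides the sum of cubes. Each
pair is counted twice, hence the `2⁻¹`. -/
theorem exists_sum_inv_cube_eq {n : ℕ} (hp : (n + 1).Prime)
    (h2 : (2 : ℚ)⁻¹ ∈ primeLocalSubring _ hp) :
    ∃ c ∈ primeLocalSubring _ hp,
      ∑ k ∈ range n, 1 / ((k : ℚ) + 1) ^ 3 = ((n : ℚ) + 1) * c := by
  have hr := sum_range_reflect (fun k : ℕ => 1 / ((k : ℚ) + 1) ^ 3) n
  have key : ∀ k ∈ range n, ∃ c ∈ primeLocalSubring _ hp,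
      1 / ((k : ℚ) + 1) ^ 3 + 1 / (((n - 1 - k : ℕ) : ℚ) + 1) ^ 3 = ((n : ℚ) + 1) * c := by
    intro k hk
    have hk := mem_range.1 hk
    have a := inv_add_one_mem hp (k := k) (by omega)
    have b := inv_add_one_mem hp (k := n - 1 - k) (by omega)
    obtain ⟨d, rfl⟩ := Nat.exists_eq_add_of_lt hk
    rw [show k + d + 1 - 1 - k = d by omega] at b ⊢
    set u := ((k : ℚ) + 1)⁻¹ with hu
    set v := ((d : ℚ) + 1)⁻¹ with hv
    refine ⟨u * v * (u ^ 2 - u * v + v ^ 2), mul_mem (mul_mem a b)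
      (add_mem (sub_mem (pow_mem a 2) (mul_mem a b)) (pow_mem b 2)), ?_⟩
    have hu1 : ((k : ℚ) + 1) * u = 1 := mul_inv_cancel₀ (by positivity)
    have hv1 : ((d : ℚ) + 1) * v = 1 := mul_inv_cancel₀ (by positivity)
    rw [one_div, one_div, ← inv_pow, ← inv_pow, ← hu, ← hv]
    push_cast
    have : u + v = ((k : ℚ) + d + 1 + 1) * (u * v) := by
      linear_combination (-v) * hu1 - u * hv1
    linear_combination (u ^ 2 - u * v + v ^ 2) * this
  choose! c hc hceq using key
  refine ⟨2⁻¹ * ∑ k ∈ range n, c k, mul_mem h2 (sum_mem hc), ?_⟩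
  have := sum_congr rfl hceq
  rw [sum_add_distrib, hr, ← mul_sum] at this
  linear_combination this / 2

/-! ### The remaining binomial sum and the conclusion -/

theorem sum_lucasNumber_sub_mem {n : ℕ} (hp : (n + 1).Prime)
    (h2 : (2 : ℚ)⁻¹ ∈ primeLocalSubring _ hp) (h5 : (5 : ℚ)⁻¹ ∈ primeLocalSubring _ hp) :
    ∃ r ∈ primeLocalSubring _ hp,
      ∑ j ∈ range n, ((n : ℚ) + 1) / (2 * (j + 1) ^ 2) * (n + 1 + j).choose (2 * j + 1) =
        2 / 5 * harmonic n + ((n : ℚ) + 1) ^ 3 * r := by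
  have hn : ((n : ℚ) + 1) ≠ 0 := by positivity
  have hu : ∀ k ∈ range n, ∃ e ∈ primeLocalSubring _ hp,
      sineProd ((n : ℚ) + 1) k = 1 + ((n : ℚ) + 1) ^ 2 * e := fun k hk => by
    simpa using exists_sineProd_eq hp (Nat.lt_succ_of_lt (mem_range.1 hk))
  have hv : ∀ k ∈ range n, ∃ f ∈ primeLocalSubring _ hp,
      (sineProd ((n : ℚ) + 1) k)⁻¹ = 1 + ((n : ℚ) + 1) ^ 2 * f := fun k hk => by
    simpa using exists_inv_sineProd_eq hp (Nat.lt_succ_of_lt (mem_range.1 hk))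
  choose! e he hu using hu
  choose! f hf hv using hv
  obtain ⟨c, hc, hcube⟩ := exists_sum_inv_cube_eq hp h2
  have hpm : (n : ℚ) + 1 ∈ primeLocalSubring _ hp := by
    exact_mod_cast natCast_mem (primeLocalSubring _ hp) (n + 1)
  -- An Apéry term can have a `p` in its denominator, but only one: `p` times it is a binomial
  -- coefficient times `p`-integral inverses.
  have hw : ∀ k ∈ range n, ((n : ℚ) + 1) * (1 / (((k : ℚ) + 1) ^ 3 * sineProd ((k : ℚ) + 1) k)) ∈
      primeLocalSubring _ hp := by
    intro k hk
    have h0 := sineProd_ne_zero (show k < n + 1 by have := mem_range.1 hk; omega)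
    have hch := choose_eq_sineProd (n + 1) k
    have h1 : ((k : ℚ) + 1) ≠ 0 := by positivity
    push_cast at h0 hch
    have : ((n : ℚ) + 1) * (1 / (((k : ℚ) + 1) ^ 3 * sineProd ((k : ℚ) + 1) k)) =
        (n + 1 + k).choose (2 * k + 1) * ((k : ℚ) + 1)⁻¹ ^ 2 *
          (sineProd ((n : ℚ) + 1) k)⁻¹ := by
      rw [hch]
      field_simp
    rw [this, hv k hk]
    exact mul_mem (mul_mem (natCast_mem _ _)
      (pow_mem (inv_add_one_mem hp (by have := mem_range.1 hk; omega)) 2))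
      (add_mem (one_mem _) (mul_mem (pow_mem hpm 2) (hf k hk)))
  have hX : ∑ j ∈ range n, ((n : ℚ) + 1) / (2 * (j + 1) ^ 2) * (n + 1 + j).choose (2 * j + 1) =
      ((n : ℚ) + 1) ^ 2 / 2 *
        ∑ k ∈ range n, 1 / (((k : ℚ) + 1) ^ 3 * sineProd ((k : ℚ) + 1) k) +
      ((n : ℚ) + 1) ^ 3 * (2⁻¹ * ∑ k ∈ range n,
        ((n : ℚ) + 1) * (1 / (((k : ℚ) + 1) ^ 3 * sineProd ((k : ℚ) + 1) k)) * e k) := by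
    rw [mul_sum, mul_sum, mul_sum, ← sum_add_distrib]
    refine sum_congr rfl fun k hk => ?_
    have hch := choose_eq_sineProd (n + 1) k
    have h0 := sineProd_ne_zero (show k < k + 1 by omega)
    have h1 : ((k : ℚ) + 1) ≠ 0 := by positivity
    push_cast at hch h0
    rw [hch, hu k hk]
    field_simp
  have hR : ∑ k ∈ range n,
        1 / (2 * ((n : ℚ) + 1) * (k + 1) * (k - n) * sineProd ((n : ℚ) + 1) k) =
      - harmonic n / ((n : ℚ) + 1) ^ 2 +
      ((n : ℚ) + 1) * (2⁻¹ * ∑ k ∈ range n, ((k : ℚ) + 1)⁻¹ * ((k : ℚ) - n)⁻¹ * f k) := by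
    -- Partial fractions, from `(k + 1) - (k - n) = p`; both halves sum to `-H_{p-1}`.
    have hH : - harmonic n / ((n : ℚ) + 1) ^ 2 = 1 / (2 * ((n : ℚ) + 1) ^ 2) *
        ∑ k ∈ range n, (((k : ℚ) - n)⁻¹ - ((k + 1 : ℕ) : ℚ)⁻¹) := by
      rw [sum_sub_distrib, sum_inv_sub_eq_neg_harmonic, ← harmonic]
      field_simp
      ring
    rw [hH, mul_sum, mul_sum, mul_sum, ← sum_add_distrib]
    refine sum_congr rfl fun k hk => ?_
    have h1 : ((k : ℚ) + 1) ≠ 0 := by positivity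
    have h3 : (k : ℚ) - n ≠ 0 := by
      have : (k : ℚ) < n := by exact_mod_cast mem_range.1 hk
      linarith
    rw [one_div, mul_inv, hv k hk]
    push_cast
    field_simp
    ring
  have hA := sum_inv_cube_eq n
  rw [hcube, hR] at hA
  refine ⟨2 * 5⁻¹ * (c - 2⁻¹ * ∑ k ∈ range n, ((k : ℚ) + 1)⁻¹ * ((k : ℚ) - n)⁻¹ * f k) +
    2⁻¹ * ∑ k ∈ range n,
        ((n : ℚ) + 1) * (1 / (((k : ℚ) + 1) ^ 3 * sineProd ((k : ℚ) + 1) k)) * e k, ?_, ?_⟩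
  · refine add_mem (mul_mem (mul_mem (ofNat_mem _ 2) h5) (sub_mem hc (mul_mem h2 (sum_mem ?_))))
      (mul_mem h2 (sum_mem fun k hk => mul_mem (hw k hk) (he k hk)))
    intro k hk
    have hk' := mem_range.1 hk
    refine mul_mem (mul_mem (inv_add_one_mem hp (by omega)) ?_) (hf k hk)
    have := inv_sub_mem hp (k := k) (by omega)
    push_cast at this
    rwa [add_sub_add_right_eq_sub] at this
  · rw [hX]
    field_simp at hA ⊢
    linear_combination (-(1 / 2 : ℚ)) * hA

theorem corollary1 (p : ℕ) (hp : p.Prime) (hodd : Odd p) :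
    (lucasNumber p : ℤ) ≡ 1 [ZMOD (p : ℤ)] ∧
    RatModEqPrimePow p 3
      (∑ k ∈ Finset.Icc 1 (p - 1), (lucasNumber (2 * k) : ℚ) / (k : ℚ))
      ((1 - (lucasNumber p : ℚ) ^ 2) / (2 * (p : ℚ)) + 12 / 5 * harmonic (p - 1)) := by
  refine ⟨lucasNumber_prime_modEq p hp, ?_⟩
  obtain ⟨n, rfl⟩ := Nat.exists_eq_add_of_lt hp.pos
  rw [zero_add] at *
  have hS : ∑ k ∈ Icc 1 (n + 1 - 1), (lucasNumber (2 * k) : ℚ) / (k : ℚ) =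
      ∑ k ∈ range n, (lucasNumber (2 * (k + 1)) : ℚ) / (k + 1) := by
    rw [Nat.add_sub_cancel, ← Finset.Ico_add_one_right_eq_Icc,
      sum_Ico_eq_sum_range, Nat.add_sub_cancel]
    refine sum_congr rfl fun k _ => ?_
    rw [add_comm 1 k]
    push_cast
    rfl
  rw [hS]
  by_cases hp5 : n + 1 = 5
  · obtain rfl : n = 4 := by omega
    -- For `p = 5` the difference of the two sides is exactly `125/4`.
    refine ⟨1 / 4, ?_, ?_⟩
    · norm_num
    · norm_num [sum_range_succ, lucasNumber, harmonic]
  have h2 := inv_intCast_mem_primeLocalSubring hp (z := 2) fun h => by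
    have := (Nat.prime_dvd_prime_iff_eq hp Nat.prime_two).1 (by exact_mod_cast h)
    rw [this] at hodd
    exact absurd hodd (by decide)
  have h5 := inv_intCast_mem_primeLocalSubring hp (z := 5) fun h =>
    hp5 ((Nat.prime_dvd_prime_iff_eq hp Nat.prime_five).1 (by exact_mod_cast h))
  obtain ⟨r, hr, h⟩ := sum_lucasNumber_sub_mem hp (by exact_mod_cast h2) (by exact_mod_cast h5)
  refine ⟨r, hr, ?_⟩
  rw [sum_lucasNumber_two_mul_div n hodd, h, Nat.add_sub_cancel]
  push_cast
  ring
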